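/- For a real number $t\neq 0$ and an integer $k\ge 1$, and for an integer $m\ge 2$, put $$S_k(t)=\sum_{n=1}^{\infty}\frac{\pi(-1)^{n-1}}{n^{2k-1}\sinh(\pi n t)},\qquad \bar\zeta(m)=\sum_{n=1}^{\infty}\frac{(-1)^{n-1}}{n^{m}}.$$ Then for every integer $k\ge 1$ and all real $x\neq 0$, $y\neq 0$, the series $S_k(y/x)$ and $S_k(x/y)$ converge absolutely and $$x^{2k-1}y\,S_k\!\left(\frac{y}{x}\right)+(-1)^k\,y^{2k-1}x\,S_k\!\left(\frac{x}{y}\right)=\left(x^{2k}+(-1)^k y^{2k}\right)\bar\zeta(2k)+2\sum_{\substack{k_1+k_2=k\\ k_1,k_2\ge 1}}(-1)^{k_2}x^{2k_1}y^{2k_2}\,\bar\zeta(2k_1)\,\bar\zeta(2k_2),$$ where $k_1,k_2$ run over integers and the last sum is $0$ when $k=1$. -/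

import Mathlib

/-- The alternating Riemann zeta function at an integer argument `m ≥ 2` (where its series
converges absolutely): `1 - 1 / 2 ^ m + 1 / 3 ^ m - ⋯`. The series is indexed from `0`, so
the usual index is `n + 1` and the sign `(-1) ^ ((n + 1) - 1)` is `(-1) ^ n`. -/
noncomputable def altZeta (m : ℕ) : ℝ :=
  ∑' n : ℕ, (-1 : ℝ) ^ n / ((n : ℝ) + 1) ^ m

/-- The series defining `altZeta m` converges for `m ≥ 2`. -/
theorem summable_altZeta {m : ℕ} (hm : 2 ≤ m) :
    Summable (fun n : ℕ => (-1 : ℝ) ^ n / ((n : ℝ) + 1) ^ m) := by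
  have h : Summable (fun n : ℕ => 1 / ((n : ℝ) + 1) ^ m) := by
    have h1 := (summable_nat_add_iff 1).2 (Real.summable_one_div_nat_pow.2 (by omega : 1 < m))
    simpa using h1
  refine Summable.of_norm (h.congr fun n => ?_)
  have : (0 : ℝ) < (n : ℝ) + 1 := by positivity
  simp [abs_of_pos this]

/-- The `n`-th term, `n = 0, 1, 2, …`, of the series
`∑_{N ≥ 1} π (-1) ^ (N - 1) / (N ^ (2 k - 1) sinh (π N t))`, with `N = n + 1`.
It is used for `k ≥ 1` and `t ≠ 0` only, so neither the subtraction `2 * k - 1` of natural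
numbers nor the division is degenerate. -/
noncomputable def cschTerm (k : ℕ) (t : ℝ) (n : ℕ) : ℝ :=
  Real.pi * (-1 : ℝ) ^ n /
    (((n : ℝ) + 1) ^ (2 * k - 1) * Real.sinh (Real.pi * ((n : ℝ) + 1) * t))

/-! Write N = n + 1, M = m + 1, k = j + 1. Expanding each cosecant in partial fractions
(`pi_div_sinh_eq`) turns each of the two series into an alternating zeta value minus twice an
iterated sum of `crossTerm` (`hasSum_tsum_crossTerm`). With X = x²/N² and Y = -y²/M², the two cross
terms, weighted as in the theorem, add up to ∓XY(X^j - Y^j)/(X - Y). This is a finite geometric sum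
of monomials X^a Y^b with a, b ≥ 1 and a + b = k, so the double sum splits into products of zeta
values.

Adding the two iterated sums requires exchanging the order of summation. For k ≥ 2 absolute
convergence allows it. For k = 1 convergence is only conditional, and consecutive terms are paired
first (`summable_crossTerm_pairs`). -/

theorem summable_one_div_succ_sq : Summable (fun n : ℕ => 1 / ((n : ℝ) + 1) ^ 2) := by
  simpa using (summable_nat_add_iff 1).2 (Real.summable_one_div_nat_pow.2 one_lt_two)

theorem summable_inv_sq_add_sq (t : ℝ) :
    Summable fun m : ℕ => 1 / (t ^ 2 + ((m : ℝ) + 1) ^ 2) := by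
  refine summable_one_div_succ_sq.of_nonneg_of_le (fun m => by positivity) fun m => ?_
  exact one_div_le_one_div_of_le (by positivity) (by nlinarith [sq_nonneg t])

/-- The partial fraction expansion of the hyperbolic cotangent. -/
theorem hasSum_inv_sq_add_sq {t : ℝ} (ht : t ≠ 0) :
    HasSum (fun m : ℕ => 1 / (t ^ 2 + ((m : ℝ) + 1) ^ 2))
      ((Real.pi * Real.cosh (Real.pi * t) / Real.sinh (Real.pi * t) - 1 / t) / (2 * t)) := by
  have htC : (t : ℂ) ≠ 0 := by exact_mod_cast ht
  have hz : (t * Complex.I : ℂ) ∈ Complex.integerComplement := by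
    rintro ⟨n, hn⟩
    have := congrArg Complex.im hn
    simp at this
    exact ht this.symm
  have hs : (Real.sinh (Real.pi * t) : ℂ) ≠ 0 := by
    exact_mod_cast fun h => mul_ne_zero Real.pi_ne_zero ht (Real.sinh_eq_zero.1 h)
  have key := cot_series_rep' hz
  have hterm : ∀ m : ℕ, (1 / ((t * Complex.I : ℂ) - (m + 1)) + 1 / (t * Complex.I + (m + 1)))
      = -(2 * t * Complex.I) * ((1 / (t ^ 2 + ((m : ℝ) + 1) ^ 2) : ℝ) : ℂ) := by
    intro m
    have h1 : (t : ℂ) ^ 2 + ((m : ℂ) + 1) ^ 2 ≠ 0 := by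
      exact_mod_cast (by positivity : t ^ 2 + ((m : ℝ) + 1) ^ 2 ≠ 0)
    have h2 : ((t * Complex.I : ℂ) - (m + 1)) * (t * Complex.I + (m + 1))
        = -(t ^ 2 + (m + 1) ^ 2) := by
      linear_combination (t : ℂ) ^ 2 * Complex.I_sq
    have h3 : ((t * Complex.I : ℂ) - (m + 1)) ≠ 0 := fun h => h1 (by
      rw [h, zero_mul] at h2; exact neg_eq_zero.1 h2.symm)
    have h4 : ((t * Complex.I : ℂ) + (m + 1)) ≠ 0 := fun h => h1 (by
      rw [h, mul_zero] at h2; exact neg_eq_zero.1 h2.symm)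
    rw [div_add_div _ _ h3 h4, h2]
    push_cast
    field_simp
    ring
  simp_rw [hterm] at key
  rw [tsum_mul_left, ← Complex.ofReal_tsum] at key
  have hcot : Complex.cot (Real.pi * (t * Complex.I))
      = -Complex.I * (Real.cosh (Real.pi * t) / Real.sinh (Real.pi * t) : ℝ) := by
    rw [Complex.cot, ← mul_assoc, Complex.cos_mul_I, Complex.sin_mul_I]
    push_cast at hs ⊢
    field_simp
    linear_combination Complex.cosh (Real.pi * t) * Complex.I_sq
  rw [hcot] at key
  have key2 := congrArg Complex.im key
  have e1 : (1 : ℂ) / (t * Complex.I) = -Complex.I * ((1 / t : ℝ) : ℂ) := by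
    push_cast
    field_simp
    linear_combination Complex.I_sq
  rw [e1] at key2
  have e2 : ∑' m : ℕ, 1 / (t ^ 2 + ((m : ℝ) + 1) ^ 2) =
      (Real.pi * Real.cosh (Real.pi * t) / Real.sinh (Real.pi * t) - 1 / t) / (2 * t) := by
    rw [eq_div_iff (by positivity)]
    simp only [Complex.sub_im, Complex.mul_im, Complex.neg_re, Complex.neg_im, Complex.I_re,
      Complex.I_im, Complex.ofReal_re, Complex.ofReal_im, Complex.mul_re, Complex.re_ofNat,
      Complex.im_ofNat] at key2
    rw [mul_div_assoc]
    linarith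
  rw [← e2]
  exact (summable_inv_sq_add_sq t).hasSum

/-- The partial fraction expansion of the hyperbolic cosecant. -/
theorem pi_div_sinh_eq {t : ℝ} (ht : t ≠ 0) :
    Real.pi / Real.sinh (Real.pi * t)
      = 1 / t - 2 * t * ∑' m : ℕ, (-1 : ℝ) ^ m / (t ^ 2 + ((m : ℝ) + 1) ^ 2) := by
  have ht2 : t / 2 ≠ 0 := by positivity
  set c : ℕ → ℝ := fun m => 1 / (t ^ 2 + ((m : ℝ) + 1) ^ 2) with hc
  have hE := hasSum_inv_sq_add_sq ht
  -- At odd index the square is (2(i + 1))², so these terms are a quarter of the expansion at `t /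
  -- 2`. The alternating sum is the full sum minus twice this one, and coth u - coth 2u = 1 / sinh
  -- 2u with u = πt/2.
  have hO : HasSum (fun i : ℕ => c (2 * i + 1)) (((Real.pi * Real.cosh (Real.pi * (t / 2)) /
      Real.sinh (Real.pi * (t / 2)) - 1 / (t / 2)) / (2 * (t / 2))) / 4) := by
    refine ((hasSum_inv_sq_add_sq ht2).div_const 4).congr_fun ?_
    intro i
    simp only [hc]
    push_cast
    rw [div_div]
    congr 1
    ring
  have hev : Summable fun i : ℕ => c (2 * i) :=
    hE.summable.comp_injective (mul_right_injective₀ (two_ne_zero' ℕ))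
  have h1 := tsum_even_add_odd hev hO.summable
  have halt : ∑' m : ℕ, (-1 : ℝ) ^ m / (t ^ 2 + ((m : ℝ) + 1) ^ 2)
      = ∑' i : ℕ, c (2 * i) - ∑' i : ℕ, c (2 * i + 1) := by
    have he : HasSum (fun i => (-1 : ℝ) ^ (2 * i) * c (2 * i)) (∑' i : ℕ, c (2 * i)) := by
      simpa [pow_mul] using hev.hasSum
    have ho : HasSum (fun i => (-1 : ℝ) ^ (2 * i + 1) * c (2 * i + 1))
        (-∑' i : ℕ, c (2 * i + 1)) := by
      simpa [pow_add, pow_mul] using hO.summable.hasSum.neg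
    rw [sub_eq_add_neg, ← (HasSum.even_add_odd (f := fun m : ℕ => (-1 : ℝ) ^ m * c m) he ho).tsum_eq]
    simp only [hc, mul_one_div]
  have h2 := hE.tsum_eq
  have h3 := hO.tsum_eq
  have hs2 : Real.sinh (Real.pi * (t / 2)) ≠ 0 :=
    fun h => mul_ne_zero Real.pi_ne_zero ht2 (Real.sinh_eq_zero.1 h)
  have hc2 : Real.cosh (Real.pi * (t / 2)) ≠ 0 := (Real.cosh_pos _).ne'
  have hpt : Real.pi * t = 2 * (Real.pi * (t / 2)) := by ring
  rw [hpt, Real.sinh_two_mul, Real.cosh_two_mul] at h2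
  rw [h3, h2] at h1
  rw [halt, h3, eq_sub_of_add_eq h1, hpt, Real.sinh_two_mul]
  have hcs := Real.cosh_sq (Real.pi * (t / 2))
  generalize Real.cosh (Real.pi * (t / 2)) = C at *
  generalize Real.sinh (Real.pi * (t / 2)) = S at *
  field_simp
  linear_combination -4 * Real.pi * t * hcs

/-! ### The cosecant series as iterated sums -/

theorem summable_cschTerm {k : ℕ} {t : ℝ} (ht : t ≠ 0) : Summable (cschTerm k t) := by
  refine Summable.of_norm_bounded (summable_one_div_succ_sq.mul_left (Real.pi * (4 / (Real.pi * |t|) ^ 2))) fun n => ?_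
  have hn : (0 : ℝ) < (n : ℝ) + 1 := by positivity
  have hpi := Real.pi_pos
  have hat : 0 < |t| := abs_pos.2 ht
  set u := Real.pi * ((n : ℝ) + 1) * |t| with hu
  have hu0 : 0 < u := by positivity
  -- A quadratic lower bound is enough: it gives a majorant of order 1/(n + 1)² whatever `k` is.
  have hsinh : u ^ 2 / 4 ≤ Real.sinh u := by
    have h1 := Real.quadratic_le_exp_of_nonneg hu0.le
    have h2 : Real.exp (-u) ≤ 1 := Real.exp_le_one_iff.2 (by linarith)
    rw [Real.sinh_eq]
    linarith
  have hpow : (1 : ℝ) ≤ ((n : ℝ) + 1) ^ (2 * k - 1) :=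
    one_le_pow₀ (by linarith [n.cast_nonneg (α := ℝ)])
  have hnorm : ‖cschTerm k t n‖ = Real.pi / (((n : ℝ) + 1) ^ (2 * k - 1) * Real.sinh u) := by
    rw [cschTerm, norm_div, norm_mul, norm_mul, norm_pow, norm_pow, norm_neg, norm_one, one_pow,
      mul_one, Real.norm_of_nonneg hpi.le, Real.norm_of_nonneg hn.le, Real.norm_eq_abs,
      Real.abs_sinh, abs_mul, abs_mul, abs_of_pos hpi, abs_of_pos hn]
  rw [hnorm]
  calc _ ≤ Real.pi / (1 * (u ^ 2 / 4)) := by gcongr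
    _ = _ := by rw [hu]; field_simp

/-- The double series whose inner sums (over `m`) occur when the hyperbolic cosecants are expanded
into partial fractions. -/
noncomputable def crossTerm (j : ℕ) (x y : ℝ) (n m : ℕ) : ℝ :=
  (-1 : ℝ) ^ n * (-1) ^ m * x ^ (2 * j + 2) * y ^ 2 /
    (((n : ℝ) + 1) ^ (2 * j) * (y ^ 2 * ((n : ℝ) + 1) ^ 2 + x ^ 2 * ((m : ℝ) + 1) ^ 2))

theorem cschTerm_eq {j : ℕ} {x y : ℝ} (hx : x ≠ 0) (hy : y ≠ 0) (n : ℕ) :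
    cschTerm (j + 1) (y / x) n * (x ^ (2 * j + 1) * y)
      = x ^ (2 * j + 2) * ((-1 : ℝ) ^ n / ((n : ℝ) + 1) ^ (2 * j + 2))
        - 2 * ∑' m, crossTerm j x y n m := by
  have hn : (n : ℝ) + 1 ≠ 0 := by positivity
  have ht : ((n : ℝ) + 1) * (y / x) ≠ 0 := by positivity
  have hterm : ∀ m, crossTerm j x y n m
      = (-1 : ℝ) ^ n * x ^ (2 * j) * y ^ 2 / ((n : ℝ) + 1) ^ (2 * j) *
        ((-1 : ℝ) ^ m / ((((n : ℝ) + 1) * (y / x)) ^ 2 + ((m : ℝ) + 1) ^ 2)) := by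
    intro m
    have h1 : y ^ 2 * ((n : ℝ) + 1) ^ 2 + x ^ 2 * ((m : ℝ) + 1) ^ 2 ≠ 0 := by positivity
    have h2 : (((n : ℝ) + 1) * (y / x)) ^ 2 + ((m : ℝ) + 1) ^ 2
        = (y ^ 2 * ((n : ℝ) + 1) ^ 2 + x ^ 2 * ((m : ℝ) + 1) ^ 2) / x ^ 2 := by
      field_simp
    rw [h2, crossTerm, pow_add]
    field_simp
  simp_rw [hterm]
  rw [tsum_mul_left]
  have key := pi_div_sinh_eq ht
  rw [← mul_assoc] at key
  have h3 : cschTerm (j + 1) (y / x) n = (-1 : ℝ) ^ n / ((n : ℝ) + 1) ^ (2 * j + 1) *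
      (Real.pi / Real.sinh (Real.pi * ((n : ℝ) + 1) * (y / x))) := by
    rw [cschTerm, div_mul_div_comm, mul_comm Real.pi]
    rfl
  rw [h3, key]
  field_simp
  ring

theorem hasSum_tsum_crossTerm {j : ℕ} {x y : ℝ} (hx : x ≠ 0) (hy : y ≠ 0) :
    HasSum (fun n => ∑' m, crossTerm j x y n m)
      ((x ^ (2 * j + 2) * altZeta (2 * j + 2)
        - (∑' n, cschTerm (j + 1) (y / x) n) * (x ^ (2 * j + 1) * y)) / 2) := by
  have h1 := (summable_altZeta (m := 2 * j + 2) (by omega)).hasSum.mul_left (x ^ (2 * j + 2))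
  have h2 := (summable_cschTerm (k := j + 1) (div_ne_zero hy hx)).hasSum.mul_right
    (x ^ (2 * j + 1) * y)
  refine ((h1.sub h2).div_const 2).congr_fun fun n => ?_
  rw [cschTerm_eq hx hy]
  ring

theorem norm_crossTerm (j : ℕ) (x y : ℝ) (n m : ℕ) :
    ‖crossTerm j x y n m‖ = x ^ (2 * j) * x ^ 2 * y ^ 2 /
      (((n : ℝ) + 1) ^ (2 * j) * (y ^ 2 * ((n : ℝ) + 1) ^ 2 + x ^ 2 * ((m : ℝ) + 1) ^ 2)) := by
  have hx2 : 0 ≤ x ^ (2 * j) := (even_two_mul j).pow_nonneg x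
  rw [crossTerm, pow_add x, norm_div, norm_mul, norm_mul, norm_mul, norm_pow, norm_pow, norm_neg,
    norm_one, one_pow, one_pow, one_mul, one_mul, Real.norm_of_nonneg (by positivity),
    Real.norm_of_nonneg (by positivity), Real.norm_of_nonneg (by positivity)]

theorem summable_crossTerm_right (j : ℕ) {x : ℝ} (hx : x ≠ 0) (y : ℝ) (n : ℕ) :
    Summable (crossTerm j x y n) := by
  refine Summable.of_norm_bounded ((summable_inv_sq_add_sq 0).mul_left
    (x ^ (2 * j) * y ^ 2 / ((n : ℝ) + 1) ^ (2 * j))) fun m => ?_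
  have hn : (0 : ℝ) < (n : ℝ) + 1 := by positivity
  have hm : (0 : ℝ) < (m : ℝ) + 1 := by positivity
  have hx2 : 0 ≤ x ^ (2 * j) := (even_two_mul j).pow_nonneg x
  have hden : 0 < x ^ 2 * ((m : ℝ) + 1) ^ 2 := by positivity
  rw [norm_crossTerm]
  calc _ ≤ x ^ (2 * j) * x ^ 2 * y ^ 2 /
      (((n : ℝ) + 1) ^ (2 * j) * (x ^ 2 * ((m : ℝ) + 1) ^ 2)) := by
        gcongr
        exact le_add_of_nonneg_left (by positivity)
    _ = _ := by field_simp; simp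

/-! ### Exchanging the order of summation -/

theorem summable_inv_rpow_mul :
    Summable fun p : ℕ × ℕ =>
      1 / ((p.1 : ℝ) + 1) ^ (3 / 2 : ℝ) * (1 / ((p.2 : ℝ) + 1) ^ (3 / 2 : ℝ)) := by
  have h : Summable (fun n : ℕ => 1 / ((n : ℝ) + 1) ^ (3 / 2 : ℝ)) := by
    simpa using (summable_nat_add_iff 1).2
      (Real.summable_one_div_nat_rpow.2 (by norm_num : (1 : ℝ) < 3 / 2))
  exact h.mul_of_nonneg h (fun n => by positivity) (fun n => by positivity)

/-- The left side is homogeneous of degree -3; splitting this evenly leaves an exponent 3/2 > 1 in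
each variable, hence a summable product. -/
theorem div_sq_add_sq_sq_le {u v : ℝ} (hu : 0 < u) (hv : 0 < v) :
    v / (u ^ 2 + v ^ 2) ^ 2 ≤ 1 / u ^ (3 / 2 : ℝ) * (1 / v ^ (3 / 2 : ℝ)) := by
  have e : ∀ w : ℝ, 0 < w → w ^ (3 / 2 : ℝ) = (√w) ^ 3 := fun w hw => by
    rw [Real.sqrt_eq_rpow, ← Real.rpow_natCast, ← Real.rpow_mul hw.le]
    norm_num
  rw [e u hu, e v hv, one_div_mul_one_div, div_le_div_iff₀ (by positivity) (by positivity), one_mul]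
  have hu' := Real.sq_sqrt hu.le
  have hv' := Real.sq_sqrt hv.le
  have ha := Real.sqrt_nonneg u
  have hb := Real.sqrt_nonneg v
  generalize √u = a at *
  generalize √v = b at *
  subst hu' hv'
  have h1 : a ^ 2 * b ^ 2 ≤ (a ^ 2) ^ 2 + (b ^ 2) ^ 2 := by
    nlinarith [sq_nonneg (a ^ 2 - b ^ 2), sq_nonneg (a ^ 2 + b ^ 2)]
  have h2 : a * b ^ 3 ≤ (a ^ 2) ^ 2 + (b ^ 2) ^ 2 := by
    nlinarith [sq_nonneg (a * b - b ^ 2), sq_nonneg (a ^ 2 - b ^ 2), sq_nonneg (a ^ 2),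
      sq_nonneg (b ^ 2)]
  calc b ^ 2 * (a ^ 3 * b ^ 3) = (a ^ 2 * b ^ 2) * (a * b ^ 3) := by ring
    _ ≤ ((a ^ 2) ^ 2 + (b ^ 2) ^ 2) * ((a ^ 2) ^ 2 + (b ^ 2) ^ 2) := by gcongr
    _ = _ := by ring

theorem crossTerm_zero_swap (x y : ℝ) (n m : ℕ) : crossTerm 0 y x m n = crossTerm 0 x y n m := by
  simp only [crossTerm]
  congr 1 <;> ring

/-- Single terms have degree -2 in (n, m), too slow for a double series. Neighbours in `m` have
opposite signs, and their sum gains one degree of decay. -/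
theorem summable_crossTerm_pairs {x y : ℝ} (hx : x ≠ 0) (hy : y ≠ 0) :
    Summable (Function.uncurry fun n i : ℕ =>
      crossTerm 0 x y n (2 * i) + crossTerm 0 x y n (2 * i + 1)) := by
  have hx2 : 0 < x ^ 2 := by positivity
  have hy2 : 0 < y ^ 2 := by positivity
  obtain ⟨c, hc, hcx, hcy⟩ : ∃ c : ℝ, 0 < c ∧ c ≤ x ^ 2 ∧ c ≤ y ^ 2 :=
    ⟨min (x ^ 2) (y ^ 2), lt_min hx2 hy2, min_le_left _ _, min_le_right _ _⟩
  refine Summable.of_norm_bounded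
    (summable_inv_rpow_mul.mul_left (4 * (x ^ 2) ^ 2 * y ^ 2 / c ^ 2)) ?_
  rintro ⟨n, i⟩
  have hi0 : (0 : ℝ) ≤ i := i.cast_nonneg
  have hn : (0 : ℝ) < (n : ℝ) + 1 := by positivity
  have hi : (0 : ℝ) < (i : ℝ) + 1 := by positivity
  set p := y ^ 2 * ((n : ℝ) + 1) ^ 2 + x ^ 2 * (2 * i + 1) ^ 2 with hp
  set q := y ^ 2 * ((n : ℝ) + 1) ^ 2 + x ^ 2 * (2 * i + 2) ^ 2 with hq
  set d := c * (((n : ℝ) + 1) ^ 2 + ((i : ℝ) + 1) ^ 2) with hd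
  have hd0 : 0 < d := by positivity
  have hdp : d ≤ p := by
    rw [hd, mul_add]
    have h1 : ((i : ℝ) + 1) ^ 2 ≤ (2 * i + 1) ^ 2 := by gcongr; linarith
    exact add_le_add (by gcongr) (by gcongr)
  have hdq : d ≤ q := hdp.trans (by rw [hp, hq]; gcongr; norm_num)
  have hp0 : 0 < p := hd0.trans_le hdp
  have hq0 : 0 < q := hd0.trans_le hdq
  have hval : crossTerm 0 x y n (2 * i) + crossTerm 0 x y n (2 * i + 1)
      = (-1) ^ n * (x ^ 2 * y ^ 2 * (x ^ 2 * (4 * i + 3)) / (p * q)) := by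
    have e1 : crossTerm 0 x y n (2 * i) = (-1) ^ n * (x ^ 2 * y ^ 2 / p) := by
      rw [crossTerm, hp]
      push_cast
      simp only [pow_mul, neg_one_sq, one_pow, pow_zero, one_mul, mul_one]
      ring
    have e2 : crossTerm 0 x y n (2 * i + 1) = (-1) ^ n * (-(x ^ 2 * y ^ 2 / q)) := by
      rw [crossTerm, hq, pow_succ (-1 : ℝ) (2 * i), show
        ((2 * i + 1 : ℕ) : ℝ) + 1 = 2 * i + 2 by push_cast; ring]
      simp only [pow_mul, neg_one_sq, one_pow, mul_zero, pow_zero, zero_add, one_mul]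
      ring
    rw [e1, e2, ← mul_add]
    congr 1
    field_simp
    rw [hp, hq]
    ring
  have hnorm : ‖Function.uncurry (fun n i : ℕ =>
      crossTerm 0 x y n (2 * i) + crossTerm 0 x y n (2 * i + 1)) (n, i)‖
      = x ^ 2 * y ^ 2 * (x ^ 2 * (4 * i + 3)) / (p * q) := by
    rw [Function.uncurry_apply_pair, hval, norm_mul, norm_pow, norm_neg, norm_one, one_pow,
      one_mul, Real.norm_of_nonneg (by positivity)]
  rw [hnorm]
  calc _ ≤ x ^ 2 * y ^ 2 * (x ^ 2 * (4 * (i + 1))) / (d * d) := by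
        gcongr
        linarith
    _ = 4 * (x ^ 2) ^ 2 * y ^ 2 / c ^ 2 *
        (((i : ℝ) + 1) / (((n : ℝ) + 1) ^ 2 + ((i : ℝ) + 1) ^ 2) ^ 2) := by
        rw [hd]
        field_simp
    _ ≤ _ := by
        gcongr
        exact div_sq_add_sq_sq_le hn hi

theorem tsum_eq_tsum_pairs {f : ℕ → ℝ} (hf : Summable f) :
    ∑' n, f n = ∑' i, (f (2 * i) + f (2 * i + 1)) := by
  have he : Summable fun i => f (2 * i) :=
    hf.comp_injective (mul_right_injective₀ (two_ne_zero' ℕ))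
  have ho : Summable fun i => f (2 * i + 1) :=
    hf.comp_injective ((add_left_injective 1).comp (mul_right_injective₀ (two_ne_zero' ℕ)))
  rw [he.tsum_add ho, tsum_even_add_odd he ho]

/-- The conditionally convergent double series may be summed in either order. -/
theorem tsum_crossTerm_zero_comm {x y : ℝ} (hx : x ≠ 0) (hy : y ≠ 0) :
    ∑' n, ∑' m, crossTerm 0 x y n m = ∑' m, ∑' n, crossTerm 0 y x m n := by
  simp_rw [tsum_eq_tsum_pairs (summable_crossTerm_right 0 hx y _)]
  -- After the exchange, the outer sum on the right is paired too; its convergence is already known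
  -- from the cosecant expansion.
  rw [← (summable_crossTerm_pairs hx hy).tsum_comm,
    tsum_eq_tsum_pairs (hasSum_tsum_crossTerm hy hx).summable]
  refine tsum_congr fun i => ?_
  rw [← (summable_crossTerm_right 0 hy x _).tsum_add (summable_crossTerm_right 0 hy x _)]
  simp_rw [crossTerm_zero_swap]

/-- For `j ≥ 1` the factor (n + 1)^(2j) supplies the decay in `n`, and the x² (m + 1)² part of the
denominator the decay in `m`. -/
theorem summable_crossTerm_uncurry {j : ℕ} (hj : 1 ≤ j) {x : ℝ} (hx : x ≠ 0) (y : ℝ) :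
    Summable (Function.uncurry (crossTerm j x y)) := by
  have h2 := (summable_one_div_succ_sq.mul_of_nonneg summable_one_div_succ_sq
    (fun n => by positivity) (fun n => by positivity)).mul_left
    (x ^ (2 * j) * y ^ 2)
  refine Summable.of_norm_bounded h2 ?_
  rintro ⟨n, m⟩
  have hn : (0 : ℝ) < (n : ℝ) + 1 := by positivity
  have hm : (0 : ℝ) < (m : ℝ) + 1 := by positivity
  have hx2 : 0 ≤ x ^ (2 * j) := (even_two_mul j).pow_nonneg x
  have hden : 0 < x ^ 2 * ((m : ℝ) + 1) ^ 2 := by positivity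
  rw [Function.uncurry_apply_pair, norm_crossTerm]
  calc _ ≤ x ^ (2 * j) * x ^ 2 * y ^ 2 /
      (((n : ℝ) + 1) ^ 2 * (x ^ 2 * ((m : ℝ) + 1) ^ 2)) := by
        gcongr
        · linarith [n.cast_nonneg (α := ℝ)]
        · omega
        · exact le_add_of_nonneg_left (by positivity)
    _ = _ := by field_simp

/-! ### Geometric sums and assembly of the identity -/

/-- Taking X Y out of every monomial leaves the full geometric sum of degree `j - 1`; for `j = 0`
both sides vanish. -/
theorem sub_mul_sum_antidiagonal_pos (X Y : ℝ) (j : ℕ) :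
    (X - Y) * ∑ p ∈ Finset.HasAntidiagonal.antidiagonal (j + 1) with 1 ≤ p.1 ∧ 1 ≤ p.2, X ^ p.1 * Y ^ p.2
      = X * Y * (X ^ j - Y ^ j) := by
  rw [Finset.sum_filter]
  cases j with
  | zero => simp [Finset.Nat.antidiagonal_succ]
  | succ i =>
    rw [Finset.Nat.antidiagonal_succ_succ']
    have h := geom_sum₂_mul X Y (i + 1)
    simp only [add_tsub_cancel_right] at h
    rw [← Finset.Nat.sum_antidiagonal_eq_sum_range_succ (fun a b => X ^ a * Y ^ b)] at h
    simp only [Finset.sum_cons, Finset.sum_map, Function.Embedding.prodMap, Prod.map,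
      Function.Embedding.coeFn_mk, Nat.succ_eq_add_one, le_add_iff_nonneg_left, zero_le, and_self,
      if_true, nonpos_iff_eq_zero, one_ne_zero, false_and, and_false, if_false, zero_add]
    have h2 : ∑ p ∈ Finset.HasAntidiagonal.antidiagonal i, X ^ (p.1 + 1) * Y ^ (p.2 + 1)
        = X * Y * ∑ p ∈ Finset.HasAntidiagonal.antidiagonal i, X ^ p.1 * Y ^ p.2 := by
      rw [Finset.mul_sum]
      exact Finset.sum_congr rfl fun p _ => by ring
    rw [h2, ← h]
    ring

/-- The two cross terms combine to a sum of products of a function of `n` and one of `m`. -/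
theorem crossTerm_add_crossTerm (j : ℕ) {x y : ℝ} (hx : x ≠ 0) (hy : y ≠ 0) (n m : ℕ) :
    crossTerm j x y n m + (-1) ^ (j + 1) * crossTerm j y x m n
      = -∑ p ∈ Finset.HasAntidiagonal.antidiagonal (j + 1) with 1 ≤ p.1 ∧ 1 ≤ p.2,
          (-1 : ℝ) ^ p.2 * x ^ (2 * p.1) * y ^ (2 * p.2) *
            (((-1 : ℝ) ^ n / ((n : ℝ) + 1) ^ (2 * p.1)) *
              ((-1 : ℝ) ^ m / ((m : ℝ) + 1) ^ (2 * p.2))) := by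
  have hn : (n : ℝ) + 1 ≠ 0 := by positivity
  have hm : (m : ℝ) + 1 ≠ 0 := by positivity
  set N := (n : ℝ) + 1
  set M := (m : ℝ) + 1
  have hd : y ^ 2 * N ^ 2 + x ^ 2 * M ^ 2 ≠ 0 := by positivity
  -- The minus sign in Y = -y²/M² absorbs the alternation in `p.2` and keeps X - Y positive.
  have hXY : x ^ 2 / N ^ 2 - -(y ^ 2 / M ^ 2) ≠ 0 := by
    rw [sub_neg_eq_add]
    positivity
  have hsum : ∑ p ∈ Finset.HasAntidiagonal.antidiagonal (j + 1) with 1 ≤ p.1 ∧ 1 ≤ p.2,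
          (-1 : ℝ) ^ p.2 * x ^ (2 * p.1) * y ^ (2 * p.2) *
            (((-1 : ℝ) ^ n / N ^ (2 * p.1)) * ((-1 : ℝ) ^ m / M ^ (2 * p.2)))
      = (-1) ^ n * (-1) ^ m * ∑ p ∈ Finset.HasAntidiagonal.antidiagonal (j + 1) with 1 ≤ p.1 ∧ 1 ≤ p.2,
          (x ^ 2 / N ^ 2) ^ p.1 * (-(y ^ 2 / M ^ 2)) ^ p.2 := by
    rw [Finset.mul_sum]
    refine Finset.sum_congr rfl fun p _ => ?_
    rw [neg_pow (y ^ 2 / M ^ 2), div_pow, div_pow]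
    simp only [← pow_mul]
    ring
  rw [hsum, eq_div_of_mul_eq hXY ((mul_comm _ _).trans (sub_mul_sum_antidiagonal_pos _ _ j))]
  have e1 : crossTerm j x y n m = (-1) ^ n * (-1) ^ m * (x ^ 2 / N ^ 2) ^ j *
      (x ^ 2 * y ^ 2 / (y ^ 2 * N ^ 2 + x ^ 2 * M ^ 2)) := by
    rw [crossTerm, div_pow, ← pow_mul, ← pow_mul, pow_add]
    field_simp
    rfl
  have e2 : (-1) ^ (j + 1) * crossTerm j y x m n = -((-1) ^ n * (-1) ^ m *
      (-(y ^ 2 / M ^ 2)) ^ j * (x ^ 2 * y ^ 2 / (y ^ 2 * N ^ 2 + x ^ 2 * M ^ 2))) := by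
    rw [crossTerm, neg_pow (y ^ 2 / M ^ 2), div_pow, ← pow_mul, ← pow_mul, pow_add y,
      add_comm (y ^ 2 * N ^ 2)]
    rw [add_comm] at hd
    change (-1) ^ (j + 1) * ((-1) ^ m * (-1) ^ n * (y ^ (2 * j) * y ^ 2) * x ^ 2 /
      (M ^ (2 * j) * (x ^ 2 * M ^ 2 + y ^ 2 * N ^ 2))) = _
    field_simp
    ring
  have e3 : x ^ 2 / N ^ 2 * -(y ^ 2 / M ^ 2) / (x ^ 2 / N ^ 2 - -(y ^ 2 / M ^ 2))
      = -(x ^ 2 * y ^ 2 / (y ^ 2 * N ^ 2 + x ^ 2 * M ^ 2)) := by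
    rw [div_eq_iff hXY]
    field_simp
    ring
  rw [e1, e2, mul_div_right_comm (_ * _), e3]
  ring

/-- The two iterated sums of the cross terms, added up. -/
theorem tsum_crossTerm_add (j : ℕ) {x y : ℝ} (hx : x ≠ 0) (hy : y ≠ 0) :
    ∑' n, ∑' m, crossTerm j x y n m + (-1) ^ (j + 1) * ∑' m, ∑' n, crossTerm j y x m n
      = -∑ p ∈ Finset.HasAntidiagonal.antidiagonal (j + 1) with 1 ≤ p.1 ∧ 1 ≤ p.2,
          (-1 : ℝ) ^ p.2 * x ^ (2 * p.1) * y ^ (2 * p.2)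
            * altZeta (2 * p.1) * altZeta (2 * p.2) := by
  rcases Nat.eq_zero_or_pos j with rfl | hj
  -- Here the sign is -1, so the equal iterated sums cancel, and no pair of positive integers has
  -- sum 1.
  · rw [tsum_crossTerm_zero_comm hx hy]
    simp [Finset.sum_filter, Finset.Nat.antidiagonal_succ]
  · have h1 := summable_crossTerm_uncurry hj hx y
    have h2 := summable_crossTerm_uncurry hj hy x
    have h2' : Summable fun p : ℕ × ℕ => crossTerm j y x p.2 p.1 := h2.prod_symm
    have e1 : ∑' n, ∑' m, crossTerm j x y n m = ∑' p, Function.uncurry (crossTerm j x y) p :=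
      h1.tsum_prod.symm
    have e2 : ∑' n, ∑' m, crossTerm j y x m n = ∑' p : ℕ × ℕ, crossTerm j y x p.2 p.1 :=
      h2'.tsum_prod.symm
    rw [← h2.tsum_comm, e1, e2, ← tsum_mul_left,
      ← Summable.tsum_add h1 (h2'.mul_left _)]
    refine HasSum.tsum_eq ?_
    simp only [Function.uncurry_def, crossTerm_add_crossTerm j hx hy]
    refine (hasSum_sum fun p hp => ?_).neg
    obtain ⟨-, hp1, hp2⟩ := Finset.mem_filter.1 hp
    have s1 := summable_altZeta (m := 2 * p.1) (by omega)
    have s2 := summable_altZeta (m := 2 * p.2) (by omega)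
    have s12 : Summable fun q : ℕ × ℕ => (-1 : ℝ) ^ q.1 / ((q.1 : ℝ) + 1) ^ (2 * p.1) *
        ((-1 : ℝ) ^ q.2 / ((q.2 : ℝ) + 1) ^ (2 * p.2)) :=
      summable_mul_of_summable_norm (f := fun n : ℕ => (-1 : ℝ) ^ n / ((n : ℝ) + 1) ^ (2 * p.1))
        (g := fun n : ℕ => (-1 : ℝ) ^ n / ((n : ℝ) + 1) ^ (2 * p.2)) s1.norm s2.norm
    have hmul := (HasSum.mul s1.hasSum s2.hasSum s12).mul_left
      ((-1 : ℝ) ^ p.2 * x ^ (2 * p.1) * y ^ (2 * p.2))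
    rw [← mul_assoc] at hmul
    exact hmul

theorem theorem2p2 (k : ℕ) (hk : 1 ≤ k) (x y : ℝ) (hx : x ≠ 0) (hy : y ≠ 0) :
    Summable (cschTerm k (y / x)) ∧ Summable (cschTerm k (x / y)) ∧
    (∑' n : ℕ, cschTerm k (y / x) n) * x ^ (2 * k - 1) * y
        + (-1 : ℝ) ^ k * (∑' n : ℕ, cschTerm k (x / y) n) * y ^ (2 * k - 1) * x
      = (x ^ (2 * k) + (-1 : ℝ) ^ k * y ^ (2 * k)) * altZeta (2 * k)
        + 2 * ∑ p ∈ Finset.HasAntidiagonal.antidiagonal k with 1 ≤ p.1 ∧ 1 ≤ p.2,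
            (-1 : ℝ) ^ p.2 * x ^ (2 * p.1) * y ^ (2 * p.2)
              * altZeta (2 * p.1) * altZeta (2 * p.2) := by
  refine ⟨summable_cschTerm (div_ne_zero hy hx), summable_cschTerm (div_ne_zero hx hy), ?_⟩
  obtain ⟨j, rfl⟩ : ∃ j, k = j + 1 := ⟨k - 1, by omega⟩
  have h1 := (hasSum_tsum_crossTerm (j := j) hx hy).tsum_eq
  have h2 := (hasSum_tsum_crossTerm (j := j) hy hx).tsum_eq
  have h3 := tsum_crossTerm_add j hx hy
  rw [h1, h2] at h3
  rw [show 2 * (j + 1) - 1 = 2 * j + 1 by omega, show 2 * (j + 1) = 2 * j + 2 by ring]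
  linear_combination -2 * h3
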